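/- All graphs are finite and may have parallel edges. A plane graph is a finite graph (parallel edges and, a priori, loops allowed) embedded in the sphere $S^2$. A graph is $2$-connected if it has at least two vertices, has no loops, is connected, and remains connected after the deletion of any one vertex. A graph $H$ is a minor of a graph $G$ if $H$ is (isomorphic to) a subgraph of a graph obtained by performing edge contractions on $G$. Let $C_m$ denote the cycle with $m$ edges, and let $B_m$ denote the bond with $m$ edges, that is, the graph with two vertices and $m$ parallel edges joining them. **Proposition.** For each integer $m\ge 3$ there is an integer $n_1=n_1(m)$ with the following property. If $G$ is a $2$-connected plane graph with at least $n_1$ edges, then $G$ contains either $C_m$ or $B_m$ as a minor. -/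

import Mathlib

namespace Graph

variable {α β γ δ : Type*}

/-- `G` is connected: it has a vertex, and any two of its vertices are joined by a walk. -/
def IsConnected (G : Graph α β) : Prop :=
  V(G).Nonempty ∧ ∀ x ∈ V(G), ∀ y ∈ V(G), Relation.ReflTransGen G.Adj x y

/-- `2`-connected multigraphs: at least two vertices, no loops, connected, and without a
cut vertex. Parallel edges are allowed; in particular every bond is `2`-connected. -/
structure IsTwoConnected (G : Graph α β) : Prop where
  nontrivial : V(G).Nontrivial
  loopless : G.Loopless
  connected : G.IsConnected
  connected_deleteVert : ∀ v ∈ V(G), (G.deleteVerts {v}).IsConnected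

open Classical in
/-- `G'` arises from `G` by contracting one edge `e` with distinct ends `x`, `y`: the edge `e`
is removed and `y` is identified with `x`. The other edges between `x` and `y` become loops, and
parallel edges are kept. -/
def ContractsTo (G G' : Graph α β) : Prop :=
  ∃ e x y, G.IsLink e x y ∧ x ≠ y ∧
    G' = (G.deleteEdges {e}).map (fun v => if v = y then x else v)

/-- Isomorphism of multigraphs: bijections of the vertex sets and of the edge sets that respect
the ends of the edges. -/
def IsIsomorphic (G : Graph α β) (H : Graph γ δ) : Prop :=
  ∃ (f : V(G) ≃ V(H)) (g : E(G) ≃ E(H)), ∀ (e : E(G)) (x y : V(G)),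
    G.IsLink e x y ↔ H.IsLink (g e) (f x) (f y)

/-- `G.HasMinor H`: up to isomorphism, `H` is a subgraph of a graph obtained from `G` by
performing edge contractions. -/
def HasMinor (G : Graph α β) (H : Graph γ δ) : Prop :=
  ∃ K : Graph α β, Relation.ReflTransGen ContractsTo G K ∧
    ∃ K' : Graph α β, K' ≤ K ∧ K'.IsIsomorphic H

/-- The cycle `C_m`, for `m ≥ 1`: its vertices are the residues modulo `m`, and for each residue
`i` it has one edge, which joins `i` to `i + 1`. -/
def cycle (m : ℕ) : Graph (ZMod m) (ZMod m) where
  vertexSet := Set.univ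
  edgeSet := Set.univ
  IsLink i x y := s(x, y) = s(i, i + 1)
  isLink_symm i _ := ⟨fun x y h => by rw [Sym2.eq_swap]; exact h⟩
  eq_or_eq_of_isLink_of_isLink i x y v w h h' := by
    have h'' : s(x, y) = s(v, w) := h.trans h'.symm
    rw [Sym2.eq_iff] at h''
    tauto
  edge_mem_iff_exists_isLink i := ⟨fun _ => ⟨i, i + 1, rfl⟩, fun _ => trivial⟩
  left_mem_of_isLink _ _ _ _ := trivial

/-- The bond `B_m`: two vertices, joined by `m` parallel edges. -/
def bond (m : ℕ) : Graph Bool (Fin m) := banana false true Set.univ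

end Graph

/-- The sphere `S²`. -/
abbrev SphereTwo : Type := Metric.sphere (0 : EuclideanSpace ℝ (Fin 3)) 1

open Graph in
/-- A plane graph: a finite multigraph embedded in the sphere `S²`. Distinct vertices are
distinct points, each edge is a simple arc (for a loop, a simple closed curve) that joins its
ends, and the interior of an edge contains no vertex and no interior point of another edge. (The
values of `point` and `arc` outside the vertex set and the edge set are irrelevant.) -/
structure PlaneGraph (α β : Type*) extends Graph α β where
  finite_vertexSet : toGraph.vertexSet.Finite
  finite_edgeSet : toGraph.edgeSet.Finite
  /-- The position of a vertex. -/
  point : α → SphereTwo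
  /-- The curve that draws an edge. -/
  arc : β → C(unitInterval, SphereTwo)
  point_injOn : Set.InjOn point toGraph.vertexSet
  arc_ends : ∀ e ∈ toGraph.edgeSet, ∃ x y, toGraph.IsLink e x y ∧
    arc e 0 = point x ∧ arc e 1 = point y
  arc_simple : ∀ e ∈ toGraph.edgeSet, ∀ s t : unitInterval, arc e s = arc e t →
    s = t ∨ (s = 0 ∧ t = 1) ∨ (s = 1 ∧ t = 0)
  arc_ne_point : ∀ e ∈ toGraph.edgeSet, ∀ v ∈ toGraph.vertexSet,
    ∀ t ∈ Set.Ioo (0 : unitInterval) 1, arc e t ≠ point v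
  arc_disjoint : ∀ e ∈ toGraph.edgeSet, ∀ f ∈ toGraph.edgeSet, e ≠ f →
    ∀ s ∈ Set.Ioo (0 : unitInterval) 1, ∀ t ∈ Set.Ioo (0 : unitInterval) 1, arc e s ≠ arc f t

/-! If some vertex `v` has at least `m` incident edges, contract the connected graph `G - v` to one
vertex: there are no loops, so those edges become a bond and `B_m` is a minor. Otherwise degrees are
bounded, and a ball of bounded radius about a fixed vertex `a` has boundedly many vertices and
edges. If `G` has more edges than that, some vertex `b` is far from `a`. By Whitney's theorem
(`IsTwoConnected.joinedTwice`), `a` and `b` are joined through two disjoint connected sets `A` and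
`B`. A path from `a` to `b` through `A` is long; keep its first `m - 1` vertices and contract the
rest of it, together with `B`, to a single vertex. This closes the kept path to a `C_m`
(`JoinedTwice.hasMinor_cycle`). Connected sets stand in for paths because they are what gets
contracted, and they can be enlarged and merged without tracking an order. -/

namespace Graph

/-! ### Connected vertex sets and their contraction -/

/-- Sets of vertices that arise from one vertex by successively adding adjacent vertices. -/
inductive ConnSet {α β : Type*} (G : Graph α β) : Set α → Prop
  | singleton (x : α) (hx : x ∈ V(G)) : ConnSet G {x}
  | insert_adj (S : Set α) (x y : α) (hS : ConnSet G S) (hx : x ∈ S) (h : G.Adj x y) :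
      ConnSet G (insert y S)

namespace ConnSet

variable {α β : Type*} {G H : Graph α β} {S T : Set α}

theorem nonempty (h : G.ConnSet S) : S.Nonempty := by
  cases h with
  | singleton x hx => exact Set.singleton_nonempty x
  | insert_adj S x y hS hx h => exact Set.insert_nonempty y S

theorem subset (h : G.ConnSet S) : S ⊆ V(G) := by
  induction h with
  | singleton x hx => simpa using hx
  | insert_adj S x y hS hx h ih => exact Set.insert_subset h.right_mem ih

theorem mono (h : H.ConnSet S) (hle : H ≤ G) : G.ConnSet S := by
  induction h with
  | singleton x hx => exact .singleton x (hle.vertexSet_mono hx)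
  | insert_adj S x y hS hx h ih => exact .insert_adj S x y ih hx (h.mono hle)

/-- Absorb `T` into `S` in the order in which `T` was built. If the contact vertex `y` is the last
one added to `T`, it joins `S` first and becomes the new link to the rest; hence the quantification
over `S`. -/
theorem union (hT : G.ConnSet T) : ∀ {S : Set α} {x y : α}, G.ConnSet S → x ∈ S → y ∈ T →
    G.Adj x y → G.ConnSet (S ∪ T) := by
  induction hT with
  | singleton z hz =>
    intro S x y hS hx hy h
    rw [Set.mem_singleton_iff] at hy
    subst hy
    simpa [Set.union_singleton] using ConnSet.insert_adj S x y hS hx h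
  | insert_adj T u z hT hu huz ih =>
    intro S x y hS hx hy h
    by_cases hyT : y ∈ T
    · have := ConnSet.insert_adj _ u z (ih hS hx hyT h) (Or.inr hu) huz
      rwa [← Set.union_insert] at this
    · obtain rfl : y = z := by simpa [hyT] using hy
      have := ih (ConnSet.insert_adj S x y hS hx h) (Set.mem_insert y S) hu huz.symm
      rwa [Set.insert_union, ← Set.union_insert] at this

/-- The simple graph of the adjacencies inside a set of vertices. -/
def _root_.Graph.simpleOn (G : Graph α β) (S : Set α) : SimpleGraph α where
  Adj x y := x ≠ y ∧ G.Adj x y ∧ x ∈ S ∧ y ∈ S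
  symm := ⟨fun _ _ h => ⟨h.1.symm, h.2.1.symm, h.2.2.2, h.2.2.1⟩⟩
  loopless := ⟨fun _ h => h.1 rfl⟩

theorem reachable (h : G.ConnSet S) : ∀ x ∈ S, ∀ y ∈ S, (G.simpleOn S).Reachable x y := by
  induction h with
  | singleton z hz =>
    rintro x rfl y rfl
    rfl
  | insert_adj S u z hS hu h ih =>
    have hle : G.simpleOn S ≤ G.simpleOn (insert z S) := fun x y hxy =>
      ⟨hxy.1, hxy.2.1, Or.inr hxy.2.2.1, Or.inr hxy.2.2.2⟩
    have key : ∀ x ∈ insert z S, (G.simpleOn (insert z S)).Reachable u x := by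
      rintro x (rfl | hx)
      · by_cases hux : u = x
        · rw [hux]
        · exact SimpleGraph.Adj.reachable ⟨hux, h, Or.inr hu, Or.inl rfl⟩
      · exact (ih u hu x hx).mono hle
    intro x hx y hy
    exact (key x hx).symm.trans (key y hy)

/-- The vertices of a finite connected graph form a connected set. -/
theorem of_isConnected (hG : G.IsConnected) (hfin : V(G).Finite) : G.ConnSet V(G) := by
  obtain ⟨⟨a, ha⟩, hconn⟩ := hG
  have hfs : {S | G.ConnSet S}.Finite := hfin.finite_subsets.subset fun S hS => hS.subset
  obtain ⟨S, hS, hmax⟩ := hfs.exists_maximal ⟨{a}, .singleton a ha⟩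
  obtain ⟨s, hs⟩ := ConnSet.nonempty hS
  have hcl : ∀ y, Relation.ReflTransGen G.Adj s y → y ∈ S := by
    intro y hy
    induction hy with
    | refl => exact hs
    | tail _ h ih =>
      exact hmax (ConnSet.insert_adj S _ _ hS ih h) (Set.subset_insert _ _) (Set.mem_insert _ _)
  have : S = V(G) := Set.Subset.antisymm (ConnSet.subset hS)
    fun y hy => hcl y (hconn s (ConnSet.subset hS hs) y hy)
  exact this ▸ hS

open Classical in
/-- A connected set of vertices can be contracted to one of its vertices. -/
theorem exists_contraction (h : G.ConnSet S) : ∃ r ∈ S, ∃ K : Graph α β,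
    Relation.ReflTransGen ContractsTo G K ∧ ∀ e x y, G.IsLink e x y → (x ∉ S ∨ y ∉ S) →
      K.IsLink e (if x ∈ S then r else x) (if y ∈ S then r else y) := by
  -- `F` collects the contracted edges, a tree spanning `S`. All other edges inside `S` survive as
  -- loops at `r`.
  suffices H : ∃ r ∈ S, ∃ F : Set β, (∀ e ∈ F, ∀ x y, G.IsLink e x y → x ∈ S ∧ y ∈ S) ∧
      Relation.ReflTransGen ContractsTo G
        ((G.deleteEdges F).map fun v => if v ∈ S then r else v) by
    obtain ⟨r, hr, F, hF, hK⟩ := H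
    refine ⟨r, hr, _, hK, fun e x y he hxy => ?_⟩
    refine IsLink.map (fun v => if v ∈ S then r else v) (u := x) (v := y) ?_
    simp only [deleteEdges_isLink]
    exact ⟨he, fun heF => by have := hF e heF x y he; tauto⟩
  induction h with
  | singleton x hx =>
    refine ⟨x, rfl, ∅, by simp, ?_⟩
    rw [deleteEdges_empty, map_eq_of_eqOn (g := id) fun v _ => by
      by_cases hv : v = x <;> simp [hv], map_id]
  | insert_adj S x y hS hx h ih =>
    obtain ⟨r, hr, F, hF, hK⟩ := ih
    by_cases hy : y ∈ S
    · rw [Set.insert_eq_of_mem hy]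
      exact ⟨r, hr, F, hF, hK⟩
    obtain ⟨e, he⟩ := h
    have hry : r ≠ y := fun hry => hy (hry ▸ hr)
    have heF : e ∉ F := fun heF => hy (hF e heF x y he).2
    refine ⟨r, Or.inr hr, F ∪ {e}, ?_, hK.tail ⟨e, r, y, ?_, hry, ?_⟩⟩
    · rintro f (hf | rfl) u v huv
      · have := hF f hf u v huv
        exact ⟨Or.inr this.1, Or.inr this.2⟩
      · rcases huv.eq_and_eq_or_eq_and_eq he with ⟨rfl, rfl⟩ | ⟨rfl, rfl⟩ <;> simp [hx]
    · have := IsLink.map (fun v => if v ∈ S then r else v)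
        (show (G.deleteEdges F).IsLink e x y by simp [he, heF])
      simpa [hx, hy] using this
    · have hcomm : ((G.deleteEdges F).map fun v => if v ∈ S then r else v).deleteEdges {e} =
          (G.deleteEdges (F ∪ {e})).map fun v => if v ∈ S then r else v := by
        refine Graph.ext rfl fun f u v => ?_
        simp only [deleteEdges_isLink, map_isLink, Relation.Map, Set.mem_union,
          Set.mem_singleton_iff]
        constructor
        · rintro ⟨⟨a, b, ⟨hab, h1⟩, h2⟩, h3⟩
          exact ⟨a, b, ⟨hab, by tauto⟩, h2⟩
        · rintro ⟨a, b, ⟨hab, h1⟩, h2⟩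
          exact ⟨⟨a, b, ⟨hab, by tauto⟩, h2⟩, by tauto⟩
      rw [hcomm, map_map]
      congr 1
      ext v
      by_cases hv : v = y
      · simp [hv, hy]
      · by_cases hvS : v ∈ S <;> simp [hv, hvS, hry]

end ConnSet

/-! ### Bonds and cycles as minors -/

section Minor

variable {α β γ δ : Type*} {G : Graph α β}

/-- An injective homomorphism of graphs has an isomorphic copy of its domain as its image. -/
theorem exists_isIsomorphic_of_injOn (K : Graph α β) (H : Graph γ δ) (f : γ → α) (g : δ → β)
    (hf : Set.InjOn f V(H)) (hg : Set.InjOn g E(H)) (hV : ∀ x ∈ V(H), f x ∈ V(K))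
    (hE : ∀ e x y, H.IsLink e x y → K.IsLink (g e) (f x) (f y)) :
    ∃ K' : Graph α β, K' ≤ K ∧ K'.IsIsomorphic H := by
  let K' : Graph α β :=
    { vertexSet := f '' V(H)
      edgeSet := g '' E(H)
      IsLink := fun e x y => ∃ d a b, H.IsLink d a b ∧ g d = e ∧ f a = x ∧ f b = y
      isLink_symm := fun _ _ => ⟨fun x y ⟨d, a, b, h, h1, h2, h3⟩ => ⟨d, b, a, h.symm, h1, h3, h2⟩⟩
      eq_or_eq_of_isLink_of_isLink := by
        rintro e x y v w ⟨d, a, b, h, rfl, rfl, rfl⟩ ⟨d', a', b', h', h1, rfl, rfl⟩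
        exact (hE _ _ _ h).left_eq_or_eq (h1 ▸ hE _ _ _ h')
      edge_mem_iff_exists_isLink := by
        intro e
        constructor
        · rintro ⟨d, hd, rfl⟩
          obtain ⟨a, b, h⟩ := exists_isLink_of_mem_edgeSet hd
          exact ⟨f a, f b, d, a, b, h, rfl, rfl, rfl⟩
        · rintro ⟨x, y, d, a, b, h, rfl, rfl, rfl⟩
          exact ⟨d, h.edge_mem, rfl⟩
      left_mem_of_isLink := by
        rintro e x y ⟨d, a, b, h, rfl, rfl, rfl⟩
        exact ⟨a, h.left_mem, rfl⟩ }
  refine ⟨K', ⟨?_, ?_⟩, (Equiv.Set.imageOfInjOn f _ hf).symm,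
    (Equiv.Set.imageOfInjOn g _ hg).symm, ?_⟩
  · rintro _ ⟨x, hx, rfl⟩
    exact hV x hx
  · rintro e x y ⟨d, a, b, h, rfl, rfl, rfl⟩
    exact hE _ _ _ h
  · intro e x y
    obtain ⟨e, rfl⟩ := (Equiv.Set.imageOfInjOn g _ hg).surjective e
    obtain ⟨x, rfl⟩ := (Equiv.Set.imageOfInjOn f _ hf).surjective x
    obtain ⟨y, rfl⟩ := (Equiv.Set.imageOfInjOn f _ hf).surjective y
    simp only [Equiv.symm_apply_apply]
    constructor
    · rintro ⟨d, a, b, h, h1, h2, h3⟩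
      obtain rfl := hg h.edge_mem e.2 h1
      obtain rfl := hf h.left_mem x.2 h2
      obtain rfl := hf h.right_mem y.2 h3
      exact h
    · intro h
      exact ⟨e, x, y, h, rfl, rfl, rfl⟩

open Classical in
/-- A vertex whose deletion leaves a connected graph is one side of a bond. -/
theorem hasMinor_bond {m : ℕ} (hm : m ≠ 0) {v : α} {S : Set α} (hS : G.ConnSet S) (hv : v ∉ S)
    (hall : ∀ e x, G.IsLink e v x → x ∈ S) (hdeg : ¬ (G.incidenceSet v).encard < m) :
    G.HasMinor (bond m) := by
  obtain ⟨r, hr, K, hK, hlink⟩ := hS.exists_contraction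
  have hrv : v ≠ r := fun h => hv (h ▸ hr)
  obtain ⟨F, hF, hFc⟩ := Set.exists_subset_encard_eq (not_lt.1 hdeg)
  have hfin : F.Finite := Set.finite_of_encard_eq_coe hFc
  have hcard : Nat.card F = m := by
    rw [Nat.card_coe_set_eq, Set.ncard_def, hFc]; rfl
  have := hfin.to_subtype
  let g : Fin m ≃ F := (Finite.equivFinOfCardEq hcard).symm
  have hl : ∀ i, K.IsLink (g i : β) v r := by
    intro i
    obtain ⟨x, hx⟩ := hF (g i).2
    have := hlink _ _ _ hx (Or.inl hv)
    rwa [if_neg hv, if_pos (hall _ _ hx)] at this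
  refine ⟨K, hK, exists_isIsomorphic_of_injOn K (bond m) (fun b => if b then r else v)
    (fun i => (g i : β)) ?_ (fun i _ j _ hij => g.injective (Subtype.ext hij)) ?_ ?_⟩
  · intro a _ b _
    cases a <;> cases b <;> simp [hrv, hrv.symm]
  · have h0 := hl ⟨0, Nat.pos_of_ne_zero hm⟩
    intro a _
    cases a
    · simpa using h0.left_mem
    · simpa using h0.right_mem
  · rintro e a b ⟨_, ⟨rfl, rfl⟩ | ⟨rfl, rfl⟩⟩
    · simpa using hl e
    · simpa using (hl e).symm

/-- A cyclic sequence of `m ≥ 3` distinct, consecutively adjacent vertices is a cycle. -/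
theorem exists_isIsomorphic_cycle (K : Graph α β) {m : ℕ} (hm : 3 ≤ m) (f : ZMod m → α)
    (hf : Function.Injective f) (hadj : ∀ i, K.Adj (f i) (f (i + 1))) :
    ∃ K' : Graph α β, K' ≤ K ∧ K'.IsIsomorphic (cycle m) := by
  choose g hg using hadj
  refine exists_isIsomorphic_of_injOn K (cycle m) f g hf.injOn ?_ (fun i _ => (hg i).left_mem) ?_
  · intro i _ j _ hij
    have := (hg i).eq_and_eq_or_eq_and_eq (hij ▸ hg j)
    rcases this with ⟨h, _⟩ | ⟨h1, h2⟩
    · exact hf h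
    · exfalso
      have h1 := hf h1
      have h2 := hf h2
      -- Two cycle edges with the same ends in opposite order would give `i = j + 1` and `i + 1 =
      -- j`, so `2 = 0` modulo `m`.
      have h3 : ((2 : ℕ) : ZMod m) = 0 := by
        have : j + (2 : ℕ) = j + 0 := by
          push_cast
          calc j + 2 = (j + 1) + 1 := by ring
            _ = j + 0 := by rw [← h1, h2, add_zero]
        exact add_left_cancel this
      rw [ZMod.natCast_eq_zero_iff] at h3
      exact absurd (Nat.le_of_dvd (by norm_num) h3) (by omega)
  · intro i x y h
    rcases Sym2.eq_iff.1 (show s(x, y) = s(i, i + 1) from h) with ⟨rfl, rfl⟩ | ⟨rfl, rfl⟩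
    · exact hg _
    · exact (hg _).symm

open Classical in
/-- A path on `k + 2` vertices, together with a disjoint connected set that is adjacent to both of
its ends, yields a cycle of length `k + 3`. -/
theorem hasMinor_cycle {k : ℕ} (v : ℕ → α) (hinj : Set.InjOn v (Set.Iic (k + 1)))
    (hadj : ∀ i ≤ k, G.Adj (v i) (v (i + 1))) {S : Set α} (hS : G.ConnSet S)
    (hdisj : ∀ i ≤ k + 1, v i ∉ S) {s t : α} (hs : s ∈ S) (ht : t ∈ S) (hs0 : G.Adj s (v 0))
    (htk : G.Adj (v (k + 1)) t) : G.HasMinor (cycle (k + 3)) := by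
  obtain ⟨r, hr, K, hK, hlink⟩ := hS.exists_contraction
  -- The last index, `k + 2`, is the contracted vertex; it closes the path to a cycle.
  let f : Fin (k + 3) → α := fun i => if (i : ℕ) ≤ k + 1 then v i else r
  have hne : ∀ i ≤ k + 1, v i ≠ r := fun i hi h => hdisj i hi (h ▸ hr)
  refine ⟨K, hK, exists_isIsomorphic_cycle K (by omega) (m := k + 3) f ?_ ?_⟩
  · change ∀ i j : Fin (k + 3), f i = f j → i = j
    intro i j hij
    change (if (i : ℕ) ≤ k + 1 then v i else r) = (if (j : ℕ) ≤ k + 1 then v j else r) at hij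
    have hi := i.isLt
    have hj := j.isLt
    apply Fin.ext
    split_ifs at hij with h1 h2 h2
    · exact hinj h1 h2 hij
    · exact absurd hij (hne _ h1)
    · exact absurd hij.symm (hne _ h2)
    · omega
  · change ∀ i : Fin (k + 3), K.Adj (f i) (f (i + 1))
    intro i
    have hi := i.isLt
    change K.Adj (if (i : ℕ) ≤ k + 1 then v i else r)
      (if ((i + 1 : Fin (k + 3)) : ℕ) ≤ k + 1 then v ((i + 1 : Fin (k + 3)) : ℕ) else r)
    rw [show ((i + 1 : Fin (k + 3)) : ℕ) = if (i : ℕ) = k + 2 then 0 else (i : ℕ) + 1 by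
      rw [Fin.val_add_one]; simp [Fin.ext_iff]]
    rcases (by omega : (i : ℕ) ≤ k ∨ (i : ℕ) = k + 1 ∨ (i : ℕ) = k + 2) with h | h | h
    · obtain ⟨e, he⟩ := hadj i h
      refine ⟨e, ?_⟩
      have := hlink e _ _ he (Or.inl (hdisj i (by omega)))
      rw [if_neg (hdisj i (by omega)), if_neg (hdisj _ (by omega))] at this
      rw [if_neg (show ¬(i : ℕ) = k + 2 by omega), if_pos (by omega), if_pos (by omega)]
      exact this
    · obtain ⟨e, he⟩ := htk
      refine ⟨e, ?_⟩
      have := hlink e _ _ he (Or.inl (hdisj _ le_rfl))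
      rw [if_neg (hdisj _ le_rfl), if_pos ht] at this
      rw [if_neg (show ¬(i : ℕ) = k + 2 by omega), if_pos (by omega), if_neg (by omega), h]
      exact this
    · obtain ⟨e, he⟩ := hs0
      refine ⟨e, ?_⟩
      have := hlink e _ _ he (Or.inr (hdisj 0 (by omega)))
      rw [if_pos hs, if_neg (hdisj 0 (by omega))] at this
      rw [if_pos h, if_neg (by omega), if_pos (by omega)]
      exact this

end Minor

/-! ### Whitney's theorem for connected sets -/

section Whitney

variable {α β : Type*} {G : Graph α β}

/-- A vertex `b` that is connected to a set `X` is adjacent to `X`, or it is joined to `X` by a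
connected set that avoids `b` and `X`. -/
theorem exists_connSet_of_reflTransGen {b y : α} {X : Set α} (hb : b ∉ X) (hyX : y ∈ X)
    (h : Relation.ReflTransGen G.Adj b y) :
    (∃ x ∈ X, G.Adj b x) ∨ ∃ R, G.ConnSet R ∧ b ∉ R ∧ Disjoint R X ∧ (∃ z ∈ R, G.Adj b z) ∧
      ∃ z ∈ R, ∃ x ∈ X, G.Adj z x := by
  -- Follow the walk until it meets `X`. `R` gathers the vertices met since the last visit to `b`,
  -- and starts afresh whenever the walk returns to `b`.
  have key : ∀ y, Relation.ReflTransGen G.Adj b y → ((∃ x ∈ X, G.Adj b x) ∨ ∃ R, G.ConnSet R ∧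
      b ∉ R ∧ Disjoint R X ∧ (∃ z ∈ R, G.Adj b z) ∧ ∃ z ∈ R, ∃ x ∈ X, G.Adj z x) ∨ y = b ∨
      ∃ R, G.ConnSet R ∧ b ∉ R ∧ Disjoint R X ∧ (∃ z ∈ R, G.Adj b z) ∧ y ∈ R := by
    intro y h
    induction h with
    | refl => exact Or.inr (Or.inl rfl)
    | @tail y z _ hyz ih =>
      rcases ih with h | rfl | ⟨R, hR, hbR, hRX, hadj, hyR⟩
      · exact Or.inl h
      · by_cases hz : z ∈ X
        · exact Or.inl (Or.inl ⟨z, hz, hyz⟩)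
        · by_cases hzb : z = y
          · exact Or.inr (Or.inl hzb)
          · exact Or.inr (Or.inr ⟨{z}, .singleton z hyz.right_mem, fun h => hzb h.symm,
              Set.disjoint_singleton_left.2 hz, ⟨z, rfl, hyz⟩, rfl⟩)
      · by_cases hz : z ∈ X
        · exact Or.inl (Or.inr ⟨R, hR, hbR, hRX, hadj, y, hyR, z, hz, hyz⟩)
        · by_cases hzb : z = b
          · exact Or.inr (Or.inl hzb)
          · obtain ⟨u, hu, hbu⟩ := hadj
            refine Or.inr (Or.inr ⟨insert z R, .insert_adj R y z hR hyR hyz, ?_, ?_,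
              ⟨u, Or.inr hu, hbu⟩, Or.inl rfl⟩)
            · rintro (h | h)
              · exact hzb h.symm
              · exact hbR h
            · exact Set.disjoint_insert_left.2 ⟨hz, hRX⟩
  rcases key y h with h | rfl | ⟨R, -, -, hRX, -, hyR⟩
  · exact h
  · exact absurd hyX hb
  · exact absurd hyX (Set.disjoint_left.1 hRX hyR)

theorem ConnSet.reflTransGen_induce {S : Set α} (hS : G.ConnSet S) {x y : α} (hx : x ∈ S)
    (hy : y ∈ S) : Relation.ReflTransGen (G.induce S).Adj x y := by
  have := (SimpleGraph.reachable_iff_reflTransGen x y).1 (hS.reachable x hx y hy)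
  refine Relation.ReflTransGen.mono (fun u v h => ?_) _ _ this
  obtain ⟨-, ⟨e, he⟩, hu, hv⟩ := h
  exact ⟨e, by simp [he, hu, hv]⟩

/-- A connected set that is adjacent to `a` and contains `b` or is adjacent to it contains a
connected set that avoids `b` and is adjacent to both. -/
theorem ConnSet.exists_subset {A : Set α} (hA : G.ConnSet A) {a b : α} (haA : a ∉ A)
    (hAa : ∃ x ∈ A, G.Adj x a) (hab : a ≠ b) (hnadj : ¬ G.Adj a b)
    (hAb : b ∈ A ∨ ∃ x ∈ A, G.Adj x b) :
    ∃ R ⊆ A, G.ConnSet R ∧ b ∉ R ∧ (∃ x ∈ R, G.Adj x a) ∧ ∃ x ∈ R, G.Adj x b := by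
  by_cases hbA : b ∈ A
  · obtain ⟨x, hx, hxa⟩ := hAa
    have hle : G.induce (insert a A) ≤ G :=
      induce_le (Set.insert_subset hxa.right_mem hA.subset)
    have h := (ConnSet.insert_adj A x a hA hx hxa).reflTransGen_induce (Or.inr hbA) (Or.inl rfl)
    rcases exists_connSet_of_reflTransGen (X := {a}) (fun h => hab h.symm) rfl h with
      ⟨y, rfl, hy⟩ | ⟨R, hR, hbR, hRa, ⟨z, hz, hbz⟩, u, hu, y, rfl, huy⟩
    · exact absurd (hy.mono hle).symm hnadj
    · refine ⟨R, fun t ht => ?_, hR.mono hle, hbR, ⟨u, hu, huy.mono hle⟩,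
        ⟨z, hz, (hbz.mono hle).symm⟩⟩
      rcases hR.subset ht with rfl | h
      · exact absurd rfl (Set.disjoint_left.1 hRa ht)
      · exact h
  · exact ⟨A, subset_rfl, hA, hbA, hAa, hAb.resolve_left hbA⟩

/-- Distinct vertices `a`, `b` are joined by two disjoint connected sets that avoid `a` and `b`,
each of them adjacent to both. -/
def JoinedTwice (G : Graph α β) (a b : α) : Prop :=
  a ≠ b ∧ ∃ A B : Set α, G.ConnSet A ∧ G.ConnSet B ∧ Disjoint A B ∧ a ∉ A ∧ a ∉ B ∧ b ∉ A ∧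
    b ∉ B ∧ (∃ x ∈ A, G.Adj x a) ∧ (∃ x ∈ B, G.Adj x a) ∧ (∃ x ∈ A, G.Adj x b) ∧
    ∃ x ∈ B, G.Adj x b

/-- The inductive step of Whitney's theorem along an edge from `w` to `b`: `A` reaches `b` by
itself, `B` reaches it through `w`, and `A` and `B ∪ {w}` are still disjoint. Both are then pruned
so as to avoid `b`. -/
theorem joinedTwice_of_connSet {a w b : α} {A B : Set α} (hab : a ≠ b) (hnadj : ¬ G.Adj a b)
    (haw : a ≠ w) (hwb : G.Adj w b) (hA : G.ConnSet A) (hB : G.ConnSet B) (hAB : Disjoint A B)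
    (haA : a ∉ A) (haB : a ∉ B) (hwA : w ∉ A) (hAa : ∃ x ∈ A, G.Adj x a)
    (hBa : ∃ x ∈ B, G.Adj x a) (hAb : b ∈ A ∨ ∃ x ∈ A, G.Adj x b) (hBw : ∃ x ∈ B, G.Adj x w) :
    G.JoinedTwice a b := by
  obtain ⟨y, hy, hya⟩ := hBa
  obtain ⟨z, hz, hzw⟩ := hBw
  have haB' : a ∉ insert w B := by simp [haw, haB]
  obtain ⟨R, hRA, hR, hbR, hRa, hRb⟩ := hA.exists_subset haA hAa hab hnadj hAb
  obtain ⟨Q, hQB, hQ, hbQ, hQa, hQb⟩ := (ConnSet.insert_adj B z w hB hz hzw).exists_subset haB'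
    ⟨y, Or.inr hy, hya⟩ hab hnadj (Or.inr ⟨w, Or.inl rfl, hwb⟩)
  exact ⟨hab, R, Q, hR, hQ, (Set.disjoint_insert_right.2 ⟨hwA, hAB⟩).mono hRA hQB,
    fun h => haA (hRA h), fun h => haB' (hQB h), hbR, hbQ, hRa, hQa, hRb, hQb⟩

/-- Whitney's theorem, with connected sets in place of paths. -/
theorem IsTwoConnected.joinedTwice (hG : G.IsTwoConnected) {a b : α} (ha : a ∈ V(G))
    (hb : b ∈ V(G)) : b = a ∨ G.Adj a b ∨ G.JoinedTwice a b := by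
  have := hG.loopless
  have hreach : ∀ {w x y : α}, w ∈ V(G) → x ∈ V(G) → y ∈ V(G) → x ≠ w → y ≠ w →
      Relation.ReflTransGen (G.deleteVerts {w}).Adj x y := by
    intro w x y hw hx hy hxw hyw
    exact (hG.connected_deleteVert w hw).2 x (by simp [hx, hxw]) y (by simp [hy, hyw])
  have hmono : ∀ {w x y}, (G.deleteVerts {w}).Adj x y → G.Adj x y := fun h => h.mono deleteVerts_le
  have hav : ∀ {w S}, (G.deleteVerts {w}).ConnSet S → w ∉ S := fun {w S} h hw => by
    have := h.subset hw
    simp at this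
  have h := hG.connected.2 a ha b hb
  clear hb
  induction h with
  | refl => exact Or.inl rfl
  | @tail w b _ hwb ih =>
    by_cases hba : b = a
    · exact Or.inl hba
    by_cases hab : G.Adj a b
    · exact Or.inr (Or.inl hab)
    refine Or.inr (Or.inr ?_)
    have hab' : a ≠ b := fun h => hba h.symm
    have hw := hwb.left_mem
    have hb := hwb.right_mem
    rcases ih with rfl | haw | ⟨haw, A, B, hA, hB, hAB, haA, haB, hwA, hwB, hAa, hBa, hAw, hBw⟩
    · exact absurd hwb hab
    · rcases exists_connSet_of_reflTransGen (X := {a}) hba rfl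
        (hreach hw hb ha hwb.ne.symm haw.ne) with ⟨x, rfl, hx⟩ |
          ⟨R, hR, hbR, hRa, ⟨u, hu, hbu⟩, z, hz, x, rfl, hzx⟩
      · exact absurd (hmono hx).symm hab
      · exact ⟨hab', {w}, R, .singleton w hw, hR.mono deleteVerts_le,
          Set.disjoint_singleton_left.2 (hav hR), haw.ne, Set.disjoint_singleton_right.1 hRa,
          hwb.ne.symm, hbR, ⟨w, rfl, haw.symm⟩, ⟨z, hz, hmono hzx⟩, ⟨w, rfl, hwb⟩,
          ⟨u, hu, (hmono hbu).symm⟩⟩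
    · by_cases hbA : b ∈ A
      · exact joinedTwice_of_connSet hab' hab haw hwb hA hB hAB haA haB hwA hAa hBa (Or.inl hbA) hBw
      by_cases hbB : b ∈ B
      · exact joinedTwice_of_connSet hab' hab haw hwb hB hA hAB.symm haB haA hwB hBa hAa
          (Or.inl hbB) hAw
      -- Since `w` is not a cut vertex, `b` reaches `{a} ∪ A ∪ B` without it. The set `R` on the way
      -- replaces `A` if it arrives at `a`; otherwise it is merged with the one of `A`, `B` at which
      -- it arrives.
      rcases exists_connSet_of_reflTransGen (X := insert a (A ∪ B)) (by simp [hba, hbA, hbB])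
        (Or.inl rfl) (hreach hw hb ha hwb.ne.symm haw) with ⟨x, hxX, hx⟩ |
          ⟨R, hR, hbR, hRX, ⟨u, hu, hbu⟩, z, hz, x, hxX, hzx⟩
      · rcases hxX with rfl | hxA | hxB
        · exact absurd (hmono hx).symm hab
        · exact joinedTwice_of_connSet hab' hab haw hwb hA hB hAB haA haB hwA hAa hBa
            (Or.inr ⟨x, hxA, (hmono hx).symm⟩) hBw
        · exact joinedTwice_of_connSet hab' hab haw hwb hB hA hAB.symm haB haA hwB hBa hAa
            (Or.inr ⟨x, hxB, (hmono hx).symm⟩) hAw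
      · have hR' := hR.mono deleteVerts_le
        have hwR := hav hR
        rw [Set.disjoint_insert_right, Set.disjoint_union_right] at hRX
        obtain ⟨haR, hRA, hRB⟩ := hRX
        rcases hxX with rfl | hxA | hxB
        · exact joinedTwice_of_connSet hab' hab haw hwb hR' hB hRB haR haB hwR
            ⟨z, hz, hmono hzx⟩ hBa (Or.inr ⟨u, hu, (hmono hbu).symm⟩) hBw
        · obtain ⟨y, hy, hya⟩ := hAa
          exact joinedTwice_of_connSet hab' hab haw hwb
            (hR'.union hA hxA hz (hmono hzx).symm) hB
            (Set.disjoint_union_left.2 ⟨hAB, hRB⟩) (by simp [haA, haR]) haB (by simp [hwA, hwR])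
            ⟨y, Or.inl hy, hya⟩ hBa (Or.inr ⟨u, Or.inr hu, (hmono hbu).symm⟩) hBw
        · obtain ⟨y, hy, hya⟩ := hBa
          exact joinedTwice_of_connSet hab' hab haw hwb
            (hR'.union hB hxB hz (hmono hzx).symm) hA
            (Set.disjoint_union_left.2 ⟨hAB.symm, hRA⟩) (by simp [haB, haR]) haA (by simp [hwB, hwR])
            ⟨y, Or.inl hy, hya⟩ hAa (Or.inr ⟨u, Or.inr hu, (hmono hbu).symm⟩) hAw

end Whitney

/-! ### Balls, distant vertices and the edge count -/

section Distance

variable {α β : Type*} {G : Graph α β}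

/-- The vertices at distance at most `k` from `a`. -/
def ball (G : Graph α β) (a : α) : ℕ → Set α
  | 0 => {a}
  | k + 1 => ball G a k ∪ ⋃ x ∈ ball G a k, {y | G.Adj x y}

theorem encard_adj_le (x : α) : {y | G.Adj x y}.encard ≤ (G.incidenceSet x).encard := by
  classical
  have hsub : {y | G.Adj x y} ⊆
      (fun e => if h : ∃ y, G.IsLink e x y then h.choose else x) '' G.incidenceSet x := by
    rintro y ⟨e, he⟩
    have h : ∃ y, G.IsLink e x y := ⟨y, he⟩
    refine ⟨e, h, ?_⟩
    simp only [dif_pos h]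
    exact h.choose_spec.right_unique he
  exact (Set.encard_le_encard hsub).trans (Set.encard_image_le _ _)

theorem encard_biUnion_le {ι γ : Type*} {s : Set ι} (hs : s.Finite) (t : ι → Set γ) {c : ℕ}
    (ht : ∀ i ∈ s, (t i).encard ≤ c) : (⋃ i ∈ s, t i).encard ≤ s.encard * c := by
  induction s, hs using Set.Finite.induction_on with
  | empty => simp
  | @insert i s hi hs ih =>
    rw [Set.biUnion_insert, Set.encard_insert_of_notMem hi, add_mul, one_mul, add_comm]
    exact (Set.encard_union_le _ _).trans
      (add_le_add (ht i (Or.inl rfl)) (ih fun j hj => ht j (Or.inr hj)))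

/-- Each vertex contributes at most `c` neighbours, so one more step multiplies the size by at most
`c + 1`. -/
theorem encard_ball_le {c : ℕ} (hdeg : ∀ x, (G.incidenceSet x).encard ≤ c) (a : α) (k : ℕ) :
    (G.ball a k).encard ≤ ((c + 1) ^ k : ℕ) := by
  induction k with
  | zero => simp [ball]
  | succ k ih =>
    have hfin : (G.ball a k).Finite := Set.finite_of_encard_le_coe ih
    calc (G.ball a (k + 1)).encard
        ≤ (G.ball a k).encard + (G.ball a k).encard * c := (Set.encard_union_le _ _).trans
          (add_le_add le_rfl (encard_biUnion_le hfin _ fun x _ => (encard_adj_le x).trans (hdeg x)))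
      _ = (G.ball a k).encard * (c + 1) := by rw [mul_add, mul_one, add_comm]
      _ ≤ ((c + 1) ^ k : ℕ) * (c + 1) := by gcongr
      _ = ((c + 1) ^ (k + 1) : ℕ) := by push_cast; rw [pow_succ]

theorem ball_mono (a : α) : Monotone (G.ball a) :=
  monotone_nat_of_le_succ fun _ => Set.subset_union_left

/-- A long cycle can be contracted to a shorter one: two vertices that are far apart and joined
twice yield a cycle as a minor. -/
theorem JoinedTwice.hasMinor_cycle {a b : α} (h : G.JoinedTwice a b) {k : ℕ}
    (hb : b ∉ G.ball a (k + 1)) : G.HasMinor (cycle (k + 3)) := by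
  obtain ⟨hab, A, B, hA, hB, hAB, haA, haB, hbA, hbB, ⟨x, hx, hxa⟩, ⟨y, hy, hya⟩, ⟨z, hz, hzb⟩,
    u, hu, hub⟩ := h
  have hT : G.ConnSet (insert b (insert a A)) :=
    .insert_adj _ z b (.insert_adj A x a hA hx hxa) (Or.inr hz) hzb
  obtain ⟨p, hp⟩ := (hT.reachable a (by simp) b (by simp)).exists_isPath
  have hadj : ∀ i < p.length, G.Adj (p.getVert i) (p.getVert (i + 1)) := fun i hi =>
    (p.adj_getVert_succ hi).2.1
  have hball : ∀ i ≤ p.length, p.getVert i ∈ G.ball a i := by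
    intro i
    induction i with
    | zero => simp [ball]
    | succ i ih =>
      intro hi
      exact Or.inr (Set.mem_biUnion (ih (by omega)) (hadj i (by omega)))
  have hlen : k + 1 < p.length := by
    by_contra hlt
    have := hball p.length le_rfl
    rw [p.getVert_length] at this
    exact hb (ball_mono a (by omega) this)
  have hinj : ∀ i ≤ p.length, ∀ j ≤ p.length, p.getVert i = p.getVert j → i = j :=
    fun i hi j hj hij => hp.getVert_injOn hi hj hij
  have hpB : ∀ i ≤ p.length, p.getVert i ∉ B := by
    intro i hi hiB
    rcases Nat.eq_zero_or_pos i with rfl | hpos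
    · exact haB (by simpa using hiB)
    · have := (p.adj_getVert_succ (i := i - 1) (by omega)).2.2.2
      rw [show i - 1 + 1 = i by omega] at this
      rcases this with h | h | h
      · exact hbB (h ▸ hiB)
      · exact haB (h ▸ hiB)
      · exact Set.disjoint_left.1 hAB h hiB
  have htail : ∀ d, k + 2 + d ≤ p.length →
      G.ConnSet (p.getVert '' Set.Icc (k + 2) (k + 2 + d)) := by
    intro d
    induction d with
    | zero =>
      intro hd
      have := ConnSet.singleton _ (hadj (k + 1) hlen).right_mem
      simpa using this
    | succ d ih =>
      intro hd
      have := ConnSet.insert_adj _ _ _ (ih (by omega))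
        (Set.mem_image_of_mem _ ⟨by omega, le_rfl⟩) (hadj (k + 2 + d) (by omega))
      rwa [← Set.image_insert_eq, Set.insert_Icc_right_eq_Icc_add_one (by omega)] at this
  obtain ⟨d, hd⟩ := Nat.exists_eq_add_of_le hlen
  -- The tail of the path ends in `b`, which is adjacent to `B`; so tail and `B` together are
  -- connected, even if the tail is `b` alone.
  have hS := hB.union (htail d (by omega))
    (Set.mem_image_of_mem p.getVert (Set.right_mem_Icc.2 (by omega))) hu
    (by rw [show k + 2 + d = p.length by omega, p.getVert_length]; exact hub.symm)
  refine Graph.hasMinor_cycle (k := k) p.getVert ?_ (fun i hi => hadj i (by omega)) hS ?_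
    (Or.inr hy) (Or.inl (Set.mem_image_of_mem _ ⟨le_rfl, by omega⟩)) (by simpa using hya)
    (hadj (k + 1) hlen)
  · intro i hi j hj hij
    simp only [Set.mem_Iic] at hi hj
    exact hinj i (by omega) j (by omega) hij
  · rintro i hi (⟨j, ⟨hj, hj'⟩, hij⟩ | h)
    · have := hinj j (by omega) i (by omega) hij
      omega
    · exact hpB i (by omega) h

/-- A finite `2`-connected graph with many edges has a long cycle or a large bond as a minor. -/
theorem IsTwoConnected.hasMinor_cycle_or_bond (hG : G.IsTwoConnected) (hV : V(G).Finite) {m : ℕ}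
    (hm : 3 ≤ m) (hE : (m + 1) ^ m * m < E(G).encard) :
    G.HasMinor (cycle m) ∨ G.HasMinor (bond m) := by
  by_contra hcon
  obtain ⟨hC, hB⟩ := not_or.1 hcon
  have := hG.loopless
  have hdeg : ∀ v, (G.incidenceSet v).encard ≤ m := by
    intro v
    by_cases hv : v ∈ V(G)
    · by_contra hlt
      refine hB (hasMinor_bond (S := V(G) \ {v}) (v := v) (by omega) ?_ (by simp) ?_
        fun h => hlt h.le)
      · have := ConnSet.of_isConnected (hG.connected_deleteVert v hv) (hV.subset (by simp))
        rw [vertexSet_deleteVerts] at this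
        exact this.mono deleteVerts_le
      · intro e x he
        exact ⟨he.right_mem, he.ne.symm⟩
    · have : G.incidenceSet v = ∅ := by
        ext e
        simpa using fun h : G.Inc e v => hv h.vertex_mem
      simp [this]
  obtain ⟨k, rfl⟩ : ∃ k, m = k + 3 := ⟨m - 3, by omega⟩
  obtain ⟨a, ha⟩ := hG.nontrivial.nonempty
  -- Radius `k + 1` would suffice; the larger radius `k + 3 = m` only simplifies the bound.
  have hsub : V(G) ⊆ G.ball a (k + 3) := by
    intro b hb
    by_contra hb'
    have hmem : ∀ {j}, j ≤ k + 3 → b ∉ G.ball a j := fun hj h => hb' (ball_mono a hj h)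
    rcases hG.joinedTwice ha hb with rfl | h | h
    · exact hmem (Nat.zero_le _) rfl
    · exact hmem (j := 1) (by omega) (Or.inr (Set.mem_biUnion (Set.mem_singleton a) h))
    · exact hC (h.hasMinor_cycle (hmem (by omega)))
  have hEsub : E(G) ⊆ ⋃ v ∈ V(G), G.incidenceSet v := by
    intro e he
    obtain ⟨x, y, h⟩ := exists_isLink_of_mem_edgeSet he
    exact Set.mem_biUnion h.left_mem ⟨y, h⟩
  refine hE.not_ge ?_
  calc E(G).encard ≤ V(G).encard * (k + 3 : ℕ) :=
        (Set.encard_le_encard hEsub).trans (encard_biUnion_le hV _ fun v _ => hdeg v)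
    _ ≤ ((k + 3 + 1) ^ (k + 3) : ℕ) * (k + 3 : ℕ) := by
        gcongr
        exact (Set.encard_le_encard hsub).trans (encard_ball_le hdeg a _)
    _ = _ := by push_cast; rfl

end Distance

end Graph

theorem proposition6 (m : ℕ) (hm : 3 ≤ m) :
    ∃ n₁ : ℕ, ∀ (α : Type*) (β : Type*) (G : PlaneGraph α β), G.toGraph.IsTwoConnected →
      n₁ ≤ G.toGraph.edgeSet.ncard →
        G.toGraph.HasMinor (Graph.cycle m) ∨ G.toGraph.HasMinor (Graph.bond m) := by
  refine ⟨(m + 1) ^ m * m + 1, fun α β G hG hE => ?_⟩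
  refine hG.hasMinor_cycle_or_bond G.finite_vertexSet hm ?_
  rw [← G.finite_edgeSet.cast_ncard_eq]
  exact_mod_cast hE
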